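/- Let $\mathcal G$ be a finite-dimensional simple complex Lie algebra with Killing form $\beta$. *Conventions.* For an involutive complex automorphism $\sigma$ of $\mathcal G$ write $\mathcal G=\mathcal K\oplus\mathcal P$ with $\sigma=\mathrm{id}_{\mathcal K}\oplus(-\mathrm{id}_{\mathcal P})$, and let $\mathcal Z(\mathcal K)$ be the centre of $\mathcal K$. A *simple complex symplectic symmetric triple* on $\mathcal G$ is a triple $(\mathcal G,\sigma,\Omega)$ where $\sigma$ is such an automorphism, $\mathcal K$ acts faithfully on $\mathcal P$, $[\mathcal P,\mathcal P]=\mathcal K$, and $\Omega$ is a non-singular, $\mathcal K$-invariant, alternating $\mathbb C$-bilinear form on $\mathcal P$; $\underline\Omega$ denotes its extension to $\mathcal G\times\mathcal G$ that vanishes as soon as one argument lies in $\mathcal K$. For $X\in\mathcal G$ let $\underline X(Y,Z)=-\beta(X,[Y,Z])$. For a Cartan subalgebra $\mathfrak h$ with root system $\phi$ and a base $\Delta$ of $\phi$, let $\{h^\Delta_\alpha\}_{\alpha\in\Delta}\subset\mathfrak h$ be the dual basis, $\alpha'(h^\Delta_\alpha)=\delta_{\alpha\alpha'}$ for $\alpha,\alpha'\in\Delta$.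 For $\alpha\in\Delta$, the pair $\{\alpha,\Delta\}$ is an *admissible system* if the highest root relative to $\Delta$ is of the form $\alpha+\sum_{\alpha'\in\Delta\setminus\{\alpha\}}n_{\alpha'}\alpha'$ with $n_{\alpha'}\in\mathbb N$. **Theorem.** 1. Let $(\mathcal G,\sigma,\Omega)$ be a simple complex symplectic symmetric triple. Then $\mathcal Z(\mathcal K)$ is contained in a Cartan subalgebra of $\mathcal G$; and for every Cartan subalgebra $\mathfrak h\supseteq\mathcal Z(\mathcal K)$, with root system $\phi$, there are an admissible system $\{\gamma,\Delta\}$ in $\phi$ and $\lambda\in\mathbb C$ such that $$\sigma=\exp\bigl(\pi i\,\mathrm{ad}\,h^\Delta_\gamma\bigr),\qquad \underline\Omega=\lambda\,\underline{h^\Delta_\gamma}.$$ 2. Conversely, let $\mathfrak h$ be a Cartan subalgebra of $\mathcal G$, $\phi$ its root system, $\Delta=\{\alpha_1,\dots,\alpha_\ell\}$ a base of $\phi$. Then for every $i$: (i) $\sigma_i=\exp(\pi i\,\mathrm{ad}\,h^\Delta_{\alpha_i})$ is an automorphism of $\mathcal G$ of order exactly $2$; let $\mathcal G=\mathcal K_i\oplus\mathcal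 P_i$ be the corresponding decomposition. (ii) $\mathcal Z(\mathcal K_i)\neq\{0\}$ if and only if $\{\alpha_i,\Delta\}$ is admissible. (iii) In that case $\dim_{\mathbb C}\mathcal Z(\mathcal K_i)=1$, and for every $\lambda\in\mathbb C\setminus\{0\}$, $\bigl(\mathcal G,\sigma_i,\lambda\,\underline{h^\Delta_{\alpha_i}}|_{\mathcal P_i\times\mathcal P_i}\bigr)$ is a simple complex symplectic symmetric triple. -/

import Mathlib

noncomputable section

namespace SymplecticTriple

/-- The exponential of an endomorphism of a finite-dimensional complex vector space, computed as
the exponential of its matrix in a basis (the result does not depend on the basis). -/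
def endExp {V : Type*} [AddCommGroup V] [Module ℂ V] [FiniteDimensional ℂ V]
    (T : V →ₗ[ℂ] V) : V →ₗ[ℂ] V :=
  Matrix.toLin (Module.finBasis ℂ V) (Module.finBasis ℂ V)
    (NormedSpace.exp (LinearMap.toMatrix (Module.finBasis ℂ V) (Module.finBasis ℂ V) T))

section RootSystem

variable {ι R M N : Type*} [CommRing R] [AddCommGroup M] [Module R M] [AddCommGroup N] [Module R N]
  {P : RootPairing ι R M N}

/-- The root `μ` is the highest root relative to the base `b`: for every root `β`, the difference
`μ - β` is a sum of simple roots. -/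
def IsHighestRoot (b : P.Base) (μ : ι) : Prop :=
  ∀ β : ι, P.root μ - P.root β ∈ AddSubmonoid.closure (P.root '' b.support)

/-- The pair formed by the simple root `α` and the base `b` is an admissible system: the highest
root has the form `α + ∑_{α' ≠ α} n_{α'} α'` with natural numbers `n_{α'}`. -/
def IsAdmissibleSystem (b : P.Base) (α : b.support) : Prop :=
  ∃ μ : ι, IsHighestRoot b μ ∧
    ∃ n : b.support → ℕ, n α = 1 ∧ P.root μ = ∑ α' : b.support, n α' • P.root α'

end RootSystem

section Lie

variable {L : Type*} [LieRing L] [LieAlgebra ℂ L]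

/-- The fixed subalgebra `K` of an automorphism `σ`. -/
def fixedPart (σ : L ≃ₗ⁅ℂ⁆ L) : LieSubalgebra ℂ L where
  carrier := {x | σ x = x}
  add_mem' {x y} (hx : σ x = x) (hy : σ y = y) := by
    change σ (x + y) = x + y
    rw [map_add, hx, hy]
  zero_mem' := map_zero σ
  smul_mem' c x (hx : σ x = x) := by
    change σ (c • x) = c • x
    rw [map_smul, hx]
  lie_mem' {x y} (hx : σ x = x) (hy : σ y = y) := by
    change σ ⁅x, y⁆ = ⁅x, y⁆
    rw [LieEquiv.map_lie, hx, hy]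

/-- The `(-1)`-eigenspace `P` of an automorphism `σ`. -/
def minusPart (σ : L ≃ₗ⁅ℂ⁆ L) : Submodule ℂ L where
  carrier := {x | σ x = -x}
  add_mem' {x y} (hx : σ x = -x) (hy : σ y = -y) := by
    change σ (x + y) = -(x + y)
    rw [map_add, hx, hy, neg_add]
  zero_mem' := by
    change σ 0 = -0
    rw [map_zero, neg_zero]
  smul_mem' c x (hx : σ x = -x) := by
    change σ (c • x) = -(c • x)
    rw [map_smul, hx, smul_neg]

theorem lie_mem_minusPart {σ : L ≃ₗ⁅ℂ⁆ L} (k : fixedPart σ) (p : minusPart σ) :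
    ⁅(k : L), (p : L)⁆ ∈ minusPart σ := by
  change σ ⁅(k : L), (p : L)⁆ = -⁅(k : L), (p : L)⁆
  rw [LieEquiv.map_lie, show σ (k : L) = k from k.2, show σ (p : L) = -p from p.2, lie_neg]

/-- The underlying pair of a symmetric triple: `σ` is an involution with `K` acting faithfully on
`P` and `[P, P] = K`. As `P` is a complex subspace, it makes no difference to take the
real or the complex span of the brackets. -/
structure IsSymmetricPair (σ : L ≃ₗ⁅ℂ⁆ L) : Prop where
  involutive : ∀ x, σ (σ x) = x
  faithful : ∀ k : fixedPart σ, (∀ p : minusPart σ, ⁅(k : L), (p : L)⁆ = 0) → k = 0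
  span_lie : Submodule.span ℂ {x : L | ∃ p q : minusPart σ, ⁅(p : L), (q : L)⁆ = x} =
    (fixedPart σ).toSubmodule

/-- `(L, σ, Ω)` is a complex symplectic symmetric triple: `(L, σ)` is a symmetric pair and `Ω` is a
`K`-invariant non-singular alternating complex bilinear form on `P`. -/
structure IsComplexTriple (σ : L ≃ₗ⁅ℂ⁆ L) (Ω : LinearMap.BilinForm ℂ (minusPart σ)) : Prop
    extends IsSymmetricPair σ where
  alt : Ω.IsAlt
  nondegenerate : Ω.Nondegenerate
  invariant : ∀ (k : fixedPart σ) (p q : minusPart σ),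
    Ω ⟨⁅(k : L), (p : L)⁆, lie_mem_minusPart k p⟩ q +
      Ω p ⟨⁅(k : L), (q : L)⁆, lie_mem_minusPart k q⟩ = 0

/-- The projection of `L = K ⊕ P` onto `P`. -/
def minusProj {σ : L ≃ₗ⁅ℂ⁆ L} (hσ : ∀ x, σ (σ x) = x) : L →ₗ[ℂ] minusPart σ where
  toFun x := ⟨(2⁻¹ : ℂ) • (x - σ x), by
    change σ ((2⁻¹ : ℂ) • (x - σ x)) = -((2⁻¹ : ℂ) • (x - σ x))
    rw [map_smul, map_sub, hσ, ← smul_neg, neg_sub]⟩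
  map_add' x y := by
    ext
    simp only [map_add, Submodule.coe_add]
    rw [← smul_add]
    congr 1
    abel
  map_smul' c x := by
    ext
    simp only [map_smul, RingHom.id_apply, SetLike.val_smul]
    rw [← smul_sub, smul_comm]

/-- The extension of a form on `P` to `L` by zero on `K`. -/
def extendForm {σ : L ≃ₗ⁅ℂ⁆ L} (hσ : ∀ x, σ (σ x) = x)
    (Ω : LinearMap.BilinForm ℂ (minusPart σ)) : LinearMap.BilinForm ℂ L :=
  Ω.compl₁₂ (minusProj hσ) (minusProj hσ)

/-- The two-form `(Y, Z) ↦ -β(X, [Y, Z])` attached to `X`, where `β` is the Killing form. -/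
def underlineForm [FiniteDimensional ℂ L] (X : L) : LinearMap.BilinForm ℂ L :=
  -((LieAlgebra.ad ℂ L : L →ₗ[ℂ] Module.End ℂ L).compr₂ (killingForm ℂ L X))

variable [FiniteDimensional ℂ L] [LieAlgebra.IsKilling ℂ L]
  {H : LieSubalgebra ℂ L} [H.IsCartanSubalgebra]

/-- The element `h_α^Δ` of `H` belonging to the basis dual to the base `Δ`. -/
def dualVector (b : (LieAlgebra.IsKilling.rootSystem H).Base) (α : b.support) : H :=
  (Module.evalEquiv ℂ H).symm (b.toWeightBasis.coord α)

/-- The dual basis is characterised by `α'(h_α^Δ) = δ_{α α'}` for simple roots `α, α'`. -/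
theorem root_dualVector (b : (LieAlgebra.IsKilling.rootSystem H).Base) (α α' : b.support) :
    (LieAlgebra.IsKilling.rootSystem H).root α' (dualVector b α) =
      Finsupp.single α' (1 : ℂ) α := by
  rw [dualVector, Module.apply_evalEquiv_symm_apply, Module.Basis.coord_apply,
    RootPairing.Base.toWeightBasis_repr_root]

/-- The endomorphism `exp(π i ad h_α^Δ)`. -/
def sigmaExp (b : (LieAlgebra.IsKilling.rootSystem H).Base) (α : b.support) : L →ₗ[ℂ] L :=
  endExp (((Real.pi : ℂ) * Complex.I) • LieAlgebra.ad ℂ L (dualVector b α : L))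

end Lie

end SymplecticTriple

end

/-! Forward direction. Extended by zero, `Ω` is a 2-cocycle `E` on the Lie algebra
(`extendForm_lie`). Writing `E(x, y) = β(D x, y)`, the cocycle identity makes `D` a derivation,
hence `D = ad X`; non-singularity of `Ω` makes `K` the exact centralizer of `X`
(`exists_extendForm_eq`). So `X ∈ Z(K)`, and in any Cartan subalgebra containing `Z(K)` the roots of
`P` are those not vanishing at `X`. Choose a base whose simple roots are nonnegative on `X` in a
suitable sense, and build the highest root by adding simple roots one at a time. Since `[P, P] ⊆ K`,
a second simple root of `P` can never be added. As every simple root occurs in the highest root,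
exactly one, `γ`, lies in `P`, with coefficient 1 (`exists_isAdmissibleSystem`). Hence `X = γ(X)
h_γ`, which determines both `σ` and `Ω`.

Converse. Roots take integer values on `h_α`, so the exponential is an involution. Its fixed algebra
contains the Cartan subalgebra and the root spaces of the other simple roots, which forces `Z(K) ⊆ ℂ
h_α`. In the admissible case `ad h_α` has eigenvalues 0 and ±1, so it kills `K` and is invertible on
`P`; otherwise some root has coefficient 2 at `α`, lies in `K`, and kills the centre. -/

noncomputable section

namespace SymplecticTriple

set_option linter.unusedSectionVars false

/-! ### Root systems: highest roots, coefficients at a simple root, adapted bases. -/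

section RootSystem

open RootPairing Set

variable {ι K M N : Type*} [Finite ι] [Field K] [CharZero K]
  [AddCommGroup M] [Module K M] [AddCommGroup N] [Module K N] {P : RootPairing ι K M N}

theorem mem_closure_root_iff (b : P.Base) {m : M} :
    m ∈ AddSubmonoid.closure (P.root '' b.support) ↔
      ∃ f : b.support → ℕ, m = ∑ j, f j • P.root j := by
  rw [← Submodule.span_nat_eq_addSubmonoidClosure, Submodule.mem_toAddSubmonoid,
    Fintype.mem_span_image_iff_exists_fun]
  exact exists_congr fun f => eq_comm

theorem root_mem_closure_of_mem_support (b : P.Base) {i : ι} (hi : i ∈ b.support) :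
    P.root i ∈ AddSubmonoid.closure (P.root '' b.support) :=
  AddSubmonoid.subset_closure ⟨i, hi, rfl⟩

theorem root_neg (i : ι) :
    letI := P.indexNeg
    P.root (-i) = -P.root i := by
  simp

section Coord

variable [P.IsRootSystem]

theorem coord_sum_smul_root (b : P.Base) (f : b.support → ℕ) (α : b.support) :
    b.toWeightBasis.coord α (∑ j, f j • P.root j) = f α := by
  classical
  simp [Finsupp.single_apply]

theorem exists_coord_eq_natCast (b : P.Base) {m : M}
    (hm : m ∈ AddSubmonoid.closure (P.root '' b.support)) (α : b.support) :
    ∃ n : ℕ, b.toWeightBasis.coord α m = n := by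
  obtain ⟨f, rfl⟩ := (mem_closure_root_iff b).1 hm
  exact ⟨f α, coord_sum_smul_root b f α⟩

theorem coord_root_of_mem_support (b : P.Base) (α j : b.support) [Decidable (j = α)] :
    b.toWeightBasis.coord α (P.root j) = if j = α then 1 else 0 := by
  rw [Module.Basis.coord_apply, b.toWeightBasis_repr_root]
  simp [Finsupp.single_apply]

theorem eq_zero_of_mem_closure_of_neg_mem_closure (b : P.Base) {m : M}
    (hm : m ∈ AddSubmonoid.closure (P.root '' b.support))
    (hm' : -m ∈ AddSubmonoid.closure (P.root '' b.support)) : m = 0 := by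
  refine b.toWeightBasis.ext_elem fun α => ?_
  obtain ⟨n, hn⟩ := exists_coord_eq_natCast b hm α
  obtain ⟨k, hk⟩ := exists_coord_eq_natCast b hm' α
  rw [map_neg, hn] at hk
  have : ((n + k : ℕ) : K) = 0 := by push_cast; rw [← hk]; ring
  have : n = 0 := by have := Nat.cast_eq_zero.1 this; omega
  simpa [this] using hn

variable [P.IsCrystallographic]

theorem isPos_iff_root_mem_closure (b : P.Base) (i : ι) :
    b.IsPos i ↔ P.root i ∈ AddSubmonoid.closure (P.root '' b.support) := by
  have h₁ : ∀ i, b.IsPos i → P.root i ∈ AddSubmonoid.closure (P.root '' b.support) := by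
    intro i hi
    refine hi.induction_on_add (fun j hj => root_mem_closure_of_mem_support b hj) ?_
    intro i j k hk hi hj
    rw [hk]
    exact add_mem hi (root_mem_closure_of_mem_support b hj)
  refine ⟨h₁ i, fun hi => ?_⟩
  let := P.indexNeg
  by_contra h
  have := h₁ _ ((Base.IsPos.neg_iff_not b i).2 h)
  rw [root_neg] at this
  exact P.ne_zero i (eq_zero_of_mem_closure_of_neg_mem_closure b hi this)

theorem pairingIn_eq_sum (b : P.Base) {μ : ι} {f : b.support → ℕ}
    (hf : P.root μ = ∑ j, f j • P.root j) (i : ι) :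
    P.pairingIn ℤ μ i = ∑ j, (f j : ℤ) * P.pairingIn ℤ j i := by
  apply FaithfulSMul.algebraMap_injective ℤ K
  simp_rw [map_sum, map_mul, algebraMap_pairingIn, ← root_coroot_eq_pairing, hf, map_sum,
    map_nsmul, LinearMap.coe_sum, Finset.sum_apply]
  simp

/-- No root lies strictly above `μ` in the order defined by the base. -/
def IsMaximalRoot (b : P.Base) (μ : ι) : Prop :=
  ∀ ν, P.root ν - P.root μ ∈ AddSubmonoid.closure (P.root '' b.support) → b.height ν ≤ b.height μ

theorem exists_isMaximalRoot_above (b : P.Base) (β : ι) :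
    ∃ μ, IsMaximalRoot b μ ∧
      P.root μ - P.root β ∈ AddSubmonoid.closure (P.root '' b.support) := by
  obtain ⟨μ, hμ, hmax⟩ := Set.exists_max_image
    {ν | P.root ν - P.root β ∈ AddSubmonoid.closure (P.root '' b.support)} b.height
    (Set.toFinite _) ⟨β, by simp⟩
  refine ⟨μ, fun ν hν => hmax ν ?_, hμ⟩
  have := add_mem hν hμ
  rwa [sub_add_sub_cancel] at this

/-- If `μ` were negative, `-μ` would lie above it, the difference being `-2μ`. -/
theorem IsMaximalRoot.isPos {b : P.Base} {μ : ι} (h : IsMaximalRoot b μ) : b.IsPos μ := by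
  let := P.indexNeg
  by_contra hn
  have hpos := (Base.IsPos.neg_iff_not b μ).2 hn
  have hmem := (isPos_iff_root_mem_closure b _).1 hpos
  have := h (-μ) (by
    rw [root_neg] at hmem ⊢
    rw [sub_eq_add_neg]
    exact add_mem hmem hmem)
  rw [Base.isPos_iff] at hpos hn
  omega

/-- A negative pairing would make `μ + α_i` a root, of height one more. -/
theorem IsMaximalRoot.pairingIn_nonneg {b : P.Base} {μ : ι} (h : IsMaximalRoot b μ) {i : ι}
    (hi : i ∈ b.support) : 0 ≤ P.pairingIn ℤ μ i := by
  have hi' := root_mem_closure_of_mem_support b hi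
  by_contra! hn
  have hne : P.root μ ≠ -P.root i := by
    intro he
    have hp := (isPos_iff_root_mem_closure b _).1 h.isPos
    rw [he] at hp
    exact P.ne_zero i (eq_zero_of_mem_closure_of_neg_mem_closure b hi' hp)
  obtain ⟨ν, hν⟩ := P.root_add_root_mem_of_pairingIn_neg hn hne
  have := h ν (by rwa [hν, add_sub_cancel_left])
  rw [b.height_add hν, Base.height_one_of_mem_support hi] at this
  omega

variable [P.IsReduced]

/-- Let `q` be the span of the simple roots occurring in `μ`. For a simple root `α_i` that does not
occur, the pairing of `μ` with its coroot is nonnegative but a sum of nonpositive terms; all terms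
vanish and the reflection in `α_i` fixes `q`. The other simple reflections preserve `q` trivially,
so `q` is everything by irreducibility. -/
theorem IsMaximalRoot.coeff_ne_zero [P.IsIrreducible] {b : P.Base} {μ : ι}
    (h : IsMaximalRoot b μ) {f : b.support → ℕ} (hf : P.root μ = ∑ j, f j • P.root j)
    (α : b.support) : f α ≠ 0 := by
  set q : Submodule K M := Submodule.span K (P.root '' {i | ∃ hi : i ∈ b.support, f ⟨i, hi⟩ ≠ 0})
    with hq
  have hqtop : q = ⊤ := by
    refine IsIrreducible.eq_top_of_invtSubmodule_reflection (P := P) q ?_ ?_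
    · refine (b.forall_mem_support_invtSubmodule_iff q).1 fun i hi => ?_
      by_cases hi' : f ⟨i, hi⟩ = 0
      · have hterm : ∀ j : b.support, (f j : ℤ) * P.pairingIn ℤ j i = 0 := by
          have hle : ∀ j ∈ (Finset.univ : Finset b.support),
              (f j : ℤ) * P.pairingIn ℤ j i ≤ 0 := by
            intro j _
            by_cases hj : (j : ι) = i
            · have : j = ⟨i, hi⟩ := Subtype.ext hj
              rw [this, hi']
              simp
            · exact mul_nonpos_of_nonneg_of_nonpos (by positivity)
                (b.pairingIn_le_zero_of_ne hj j.2 hi)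
          have hsum := h.pairingIn_nonneg hi
          rw [pairingIn_eq_sum b hf] at hsum
          have := (Finset.sum_eq_zero_iff_of_nonpos hle).1
            (le_antisymm (Finset.sum_nonpos hle) hsum)
          exact fun j => this j (Finset.mem_univ j)
        rw [Module.End.mem_invtSubmodule, hq, Submodule.span_le]
        rintro - ⟨j, ⟨hj, hfj⟩, rfl⟩
        have h0 : P.pairing j i = 0 := by
          have := (mul_eq_zero.1 (hterm ⟨j, hj⟩)).resolve_left (by exact_mod_cast hfj)
          rw [← P.algebraMap_pairingIn ℤ, this, map_zero]
        have : P.reflection i (P.root j) = P.root j := by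
          rw [P.reflection_apply_root, h0, zero_smul, sub_zero]
        rw [SetLike.mem_coe, Submodule.mem_comap, LinearEquiv.coe_coe, this]
        exact Submodule.subset_span ⟨j, ⟨hj, hfj⟩, rfl⟩
      · exact Submodule.mem_invtSubmodule_reflection_of_mem _ _
          (Submodule.subset_span ⟨i, ⟨hi, hi'⟩, rfl⟩)
    · intro hbot
      have : P.root μ ∈ q := by
        rw [hf]
        refine Submodule.sum_mem _ fun j _ => ?_
        by_cases hj : f j = 0
        · simp [hj]
        · exact Submodule.smul_of_tower_mem _ _ (Submodule.subset_span ⟨j, ⟨j.2, hj⟩, rfl⟩)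
      rw [hbot, Submodule.mem_bot] at this
      exact P.ne_zero μ this
  intro hα
  classical
  have hker : q ≤ LinearMap.ker (b.toWeightBasis.coord α) := by
    rw [hq, Submodule.span_le]
    rintro - ⟨j, ⟨hj, hfj⟩, rfl⟩
    change b.toWeightBasis.coord α (P.root ((⟨j, hj⟩ : b.support) : ι)) = 0
    rw [coord_root_of_mem_support, if_neg]
    rintro rfl
    exact hfj hα
  have := hker (show P.root α ∈ q from hqtop ▸ Submodule.mem_top)
  rw [LinearMap.mem_ker, coord_root_of_mem_support, if_pos rfl] at this
  exact one_ne_zero this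

/-- Expand `ν` in simple roots: all coefficients are positive, no simple root pairs negatively with
`μ`, and one pairs positively because `μ` is positive. -/
theorem IsMaximalRoot.pairingIn_pos [P.IsIrreducible] {b : P.Base} {μ ν : ι}
    (hμ : IsMaximalRoot b μ) (hν : IsMaximalRoot b ν) : 0 < P.pairingIn ℤ ν μ := by
  obtain ⟨f, hf⟩ := (mem_closure_root_iff b).1 ((isPos_iff_root_mem_closure b _).1 hν.isPos)
  obtain ⟨j, hj, hpos⟩ := hμ.isPos.exists_mem_support_pos_pairingIn
  rw [pairingIn_eq_sum b hf]
  refine Finset.sum_pos' (fun i _ => mul_nonneg (by positivity) ?_) ⟨⟨j, hj⟩, Finset.mem_univ _, ?_⟩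
  · by_contra! hlt
    rw [P.pairingIn_lt_zero_iff] at hlt
    exact absurd (hμ.pairingIn_nonneg i.2) (not_le.2 hlt)
  · exact mul_pos (by exact_mod_cast Nat.pos_of_ne_zero (hν.coeff_ne_zero hf _)) hpos

/-- Otherwise `μ - ν` is a root; according to its sign one of `μ`, `ν` lies strictly above the
other. -/
theorem IsMaximalRoot.eq [P.IsIrreducible] {b : P.Base} {μ ν : ι}
    (hμ : IsMaximalRoot b μ) (hν : IsMaximalRoot b ν) : μ = ν := by
  by_contra hne
  obtain ⟨ρ, hρ⟩ := P.root_sub_root_mem_of_pairingIn_pos (hν.pairingIn_pos hμ) hne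
  have hht := b.height_sub hρ
  have h0 := b.height_ne_zero ρ
  rcases b.root_mem_or_neg_mem ρ with h | h
  · have h1 := (Base.isPos_iff b).1 ((isPos_iff_root_mem_closure b ρ).2 h)
    have h2 := hν μ (hρ ▸ h)
    omega
  · have h2 := hμ ν (by rwa [hρ, neg_sub] at h)
    let := P.indexNeg
    rw [← root_neg] at h
    have h1 := (Base.isPos_iff b).1 ((isPos_iff_root_mem_closure b _).2 h)
    rw [b.height_reflectionPerm_self] at h1
    omega

/-- Every irreducible reduced crystallographic root system has a highest root. -/
theorem exists_isHighestRoot [Nonempty ι] [P.IsIrreducible] (b : P.Base) :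
    ∃ μ, IsHighestRoot b μ := by
  obtain ⟨μ, hμ, -⟩ := exists_isMaximalRoot_above b (Classical.arbitrary ι)
  refine ⟨μ, fun β => ?_⟩
  obtain ⟨ν, hν, h⟩ := exists_isMaximalRoot_above b β
  rwa [hμ.eq hν]

theorem IsHighestRoot.exists_eq_sum {b : P.Base} {μ : ι} (hμ : IsHighestRoot b μ) :
    ∃ n : b.support → ℕ, (∀ α, 1 ≤ n α) ∧ P.root μ = ∑ j, n j • P.root j := by
  classical
  have : Nonempty ι := ⟨μ⟩
  obtain ⟨α₀, hα₀⟩ := b.support_nonempty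
  have hmem := add_mem (hμ α₀) (root_mem_closure_of_mem_support b hα₀)
  rw [sub_add_cancel] at hmem
  obtain ⟨n, hn⟩ := (mem_closure_root_iff b).1 hmem
  refine ⟨n, fun α => ?_, hn⟩
  obtain ⟨k, hk⟩ := exists_coord_eq_natCast b (hμ α) α
  rw [map_sub, coord_root_of_mem_support, if_pos rfl, hn, coord_sum_smul_root] at hk
  have : n α = k + 1 := by
    have : (n α : K) = ((k + 1 : ℕ) : K) := by push_cast; rw [← hk]; ring
    exact_mod_cast this
  omega

theorem exists_coord_root_eq_intCast (b : P.Base) (α : b.support) (i : ι) :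
    ∃ n : ℤ, b.toWeightBasis.coord α (P.root i) = n := by
  rcases b.root_mem_or_neg_mem i with h | h
  · obtain ⟨n, hn⟩ := exists_coord_eq_natCast b h α
    exact ⟨n, by simpa using hn⟩
  · obtain ⟨n, hn⟩ := exists_coord_eq_natCast b h α
    rw [map_neg] at hn
    exact ⟨-n, by push_cast; rw [← hn, neg_neg]⟩

/-- For a positive root `β`, the coefficients of `β` and `μ - β` at `α` are natural numbers with sum
1. -/
theorem IsAdmissibleSystem.coord_root {b : P.Base} {α : b.support}
    (h : IsAdmissibleSystem b α) (i : ι) :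
    b.toWeightBasis.coord α (P.root i) = 0 ∨ b.toWeightBasis.coord α (P.root i) = 1 ∨
      b.toWeightBasis.coord α (P.root i) = -1 := by
  let := P.indexNeg
  obtain ⟨μ, hμ, n, hn, hsum⟩ := h
  have key : ∀ i, P.root i ∈ AddSubmonoid.closure (P.root '' b.support) →
      b.toWeightBasis.coord α (P.root i) = 0 ∨ b.toWeightBasis.coord α (P.root i) = 1 := by
    intro i hi
    obtain ⟨k, hk⟩ := exists_coord_eq_natCast b hi α
    obtain ⟨l, hl⟩ := exists_coord_eq_natCast b (hμ i) α
    rw [map_sub, hsum, coord_sum_smul_root, hn, hk] at hl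
    have : k + l = 1 := by
      have : ((k + l : ℕ) : K) = ((1 : ℕ) : K) := by
        rw [Nat.cast_add, ← hl]
        ring
      exact_mod_cast this
    rw [hk]
    rcases (by omega : k = 0 ∨ k = 1) with rfl | rfl <;> simp
  rcases b.root_mem_or_neg_mem i with hi | hi
  · exact (key i hi).imp_right Or.inl
  · rw [← root_neg] at hi
    have := key _ hi
    rw [root_neg, map_neg, neg_eq_zero, neg_eq_iff_eq_neg] at this
    exact this.imp_right Or.inr

/-- If the simple root `α` does not form an admissible system with the base, then some root has
coefficient `2` at `α`. -/
theorem exists_coord_root_eq_two [Nonempty ι] [P.IsIrreducible] {b : P.Base} {α : b.support}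
    (h : ¬ IsAdmissibleSystem b α) : ∃ i, b.toWeightBasis.coord α (P.root i) = 2 := by
  classical
  obtain ⟨μ, hμ⟩ := exists_isHighestRoot b
  obtain ⟨n, hn, hsum⟩ := hμ.exists_eq_sum
  have hn2 : 2 ≤ n α := by
    have h1 := hn α
    have h2 : n α ≠ 1 := fun h1 => h ⟨μ, hμ, n, h1, hsum⟩
    omega
  have hpos : b.IsPos μ :=
    (isPos_iff_root_mem_closure b μ).2 ((mem_closure_root_iff b).2 ⟨n, hsum⟩)
  -- Adding one simple root at a time raises the coefficient at `α` by 0 or 1, so it cannot skip 2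
  -- on the way up to `μ`.
  have key : ∃ k : ℕ, b.toWeightBasis.coord α (P.root μ) = k ∧
      (2 ≤ k → ∃ i, b.toWeightBasis.coord α (P.root i) = 2) := by
    refine hpos.induction_on_add (p := fun j => ∃ k : ℕ, b.toWeightBasis.coord α (P.root j) = k ∧
      (2 ≤ k → ∃ i, b.toWeightBasis.coord α (P.root i) = 2)) ?_ ?_
    · intro i hi
      have := coord_root_of_mem_support b α ⟨i, hi⟩
      split_ifs at this
      · exact ⟨1, by simpa using this, by omega⟩
      · exact ⟨0, by simpa using this, by omega⟩
    · rintro i j l hl ⟨k, hk, hk'⟩ hj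
      have := coord_root_of_mem_support b α ⟨j, hj⟩
      split_ifs at this
      · have hcl : b.toWeightBasis.coord α (P.root l) = (k + 1 : ℕ) := by
          rw [hl, map_add, hk, this]
          push_cast
          rfl
        refine ⟨k + 1, hcl, fun h2 => ?_⟩
        rcases (by omega : 2 ≤ k ∨ k = 1) with h3 | rfl
        · exact hk' h3
        · exact ⟨l, by rw [hcl]; norm_num⟩
      · exact ⟨k, by rw [hl, map_add, hk, this, add_zero], hk'⟩
  obtain ⟨k, hk, hk'⟩ := key
  rw [hsum, coord_sum_smul_root] at hk
  exact hk' (by have : n α = k := by exact_mod_cast hk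
                omega)

/-- There is a base whose simple roots all take nonnegative values under a given functional. -/
theorem exists_base_forall_nonneg (P : RootPairing ι K M N) [P.IsRootSystem] [P.IsCrystallographic]
    [P.IsReduced] (f : M →+ ℚ) : ∃ b : P.Base, ∀ i ∈ b.support, 0 ≤ f (P.root i) := by
  let _ : Module ℚ M := Module.compHom M (algebraMap ℚ K)
  let := P.indexNeg
  obtain ⟨g, hg⟩ : ∃ g : Module.Dual ℚ M, ∀ i, g (P.root i) ≠ 0 :=
    Module.exists_dual_forall_apply_ne_zero P.root <| by simp [P.ne_zero]
  -- The quotient is 0 where `f` vanishes, which does no harm: the bound is used only where `f ≠ 0`.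
  obtain ⟨B, hB⟩ := (Set.finite_range fun i => |g (P.root i)| / |f (P.root i)|).bddAbove
  obtain ⟨n, hn⟩ := exists_nat_gt B
  have hlt : ∀ i, f (P.root i) ≠ 0 → |g (P.root i)| < n * |f (P.root i)| := by
    intro i hi
    have h1 : |g (P.root i)| / |f (P.root i)| < n := (hB ⟨i, rfl⟩).trans_lt hn
    exact (div_lt_iff₀ (abs_pos.2 hi)).1 h1
  -- A perturbation of `f` that vanishes on no root and has the sign of `f` wherever `f ≠ 0`; its
  -- indecomposable positive roots form the base.
  let F : M →+ ℚ := n • f + (g : M →+ ℚ)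
  have hF : ∀ m, F m = n * f m + g m := fun m => by simp [F]
  have hF0 : ∀ i, F (P.root i) ≠ 0 := by
    intro i h0
    rw [hF] at h0
    by_cases hi : f (P.root i) = 0
    · rw [hi, mul_zero, zero_add] at h0
      exact hg i h0
    · have := hlt i hi
      rw [eq_neg_of_add_eq_zero_right h0, abs_neg, abs_mul, Nat.abs_cast] at this
      exact lt_irrefl _ this
  refine ⟨Base.mk' P (IsAddIndecomposable.baseOf P.root F) (P.linearIndepOn_root_baseOf F hF0)
    fun i => IsAddIndecomposable.mem_or_neg_mem_closure_baseOf P.root F i (hF0 i) (by simp), ?_⟩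
  intro i hi
  have hi : i ∈ IsAddIndecomposable.baseOf P.root F := by simpa [Base.mk'] using hi
  have hpos := IsAddIndecomposable.baseOf_subset_pos P.root F hi
  have hpos : 0 < F (P.root i) := hpos
  by_contra! hneg
  have h1 := hlt i hneg.ne
  rw [abs_of_neg hneg, abs_lt] at h1
  rw [hF] at hpos
  linarith [h1.2]

end Coord

end RootSystem

/-! ### Exponentials on eigenvectors. -/

section Exponential

open scoped Matrix.Norms.Operator in
theorem exp_mulVec_of_mulVec_eq_smul {n : Type*} [Fintype n] [DecidableEq n]
    {A : Matrix n n ℂ} {w : n → ℂ} {c : ℂ} (h : A.mulVec w = c • w) :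
    (NormedSpace.exp A).mulVec w = Complex.exp c • w := by
  have hpow : ∀ k : ℕ, (A ^ k).mulVec w = c ^ k • w := by
    intro k
    induction k with
    | zero => simp
    | succ k ih =>
      rw [pow_succ, ← Matrix.mulVec_mulVec, h, Matrix.mulVec_smul, ih, smul_smul, pow_succ']
  have h₁ := (NormedSpace.exp_series_hasSum_exp' (𝕂 := ℂ) A).map
    ((Matrix.mulVecBilin ℂ ℂ).flip w : Matrix n n ℂ →ₗ[ℂ] n → ℂ)
    (LinearMap.continuous_of_finiteDimensional _)
  have h₂ := (NormedSpace.exp_series_hasSum_exp' (𝕂 := ℂ) c).smul_const w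
  rw [← Complex.exp_eq_exp_ℂ] at h₂
  refine h₁.unique ?_
  convert h₂ using 1
  funext k
  simp [hpow, smul_smul]

theorem endExp_apply_of_apply_eq_smul {V : Type*} [AddCommGroup V] [Module ℂ V]
    [FiniteDimensional ℂ V] {T : V →ₗ[ℂ] V} {v : V} {c : ℂ} (h : T v = c • v) :
    endExp T v = Complex.exp c • v := by
  apply (Module.finBasis ℂ V).repr.injective
  apply DFunLike.coe_injective
  rw [endExp, ← LinearMap.toMatrix_mulVec_repr (Module.finBasis ℂ V), LinearMap.toMatrix_toLin,
    exp_mulVec_of_mulVec_eq_smul (c := c), map_smul]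
  · rfl
  · rw [LinearMap.toMatrix_mulVec_repr, h, map_smul]
    rfl

end Exponential

/-! ### Root spaces and the automorphism `exp(π i ad h_α)`. -/

section Lie

open LieAlgebra LieAlgebra.IsKilling LieModule

variable {L : Type*} [LieRing L] [LieAlgebra ℂ L] [FiniteDimensional ℂ L] [IsKilling ℂ L]
  {H : LieSubalgebra ℂ L} [H.IsCartanSubalgebra]

theorem rootSpace_induction (H : LieSubalgebra ℂ L) [H.IsCartanSubalgebra] {p : L → Prop}
    (hmem : ∀ χ : Weight ℂ H L, ∀ x ∈ rootSpace H χ, p x)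
    (zero : p 0) (hadd : ∀ x y, p x → p y → p (x + y)) (x : L) : p x := by
  have hx : x ∈ ⨆ χ : Weight ℂ H L, rootSpace H χ := by
    rw [iSup_genWeightSpace_eq_top' ℂ H L]
    trivial
  exact LieSubmodule.iSup_induction (motive := p) _ hx hmem zero hadd

theorem weight_isZero_or_exists_root (χ : Weight ℂ H L) : χ.IsZero ∨ ∃ i : H.root, i.1 = χ := by
  by_cases h : χ.IsZero
  · exact Or.inl h
  · exact Or.inr ⟨⟨χ, by simpa using h⟩, rfl⟩

theorem apply_dualVector (b : (rootSystem H).Base) (α : b.support) (φ : Module.Dual ℂ H) :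
    φ (dualVector b α) = b.toWeightBasis.coord α φ := by
  rw [dualVector, Module.apply_evalEquiv_symm_apply]

theorem root_apply_dualVector (b : (rootSystem H).Base) (α : b.support) (i : H.root) :
    i.1 (dualVector b α) = b.toWeightBasis.coord α ((rootSystem H).root i) := by
  rw [← apply_dualVector]
  rfl

/-- An element of the Cartan subalgebra is determined by the values of the simple roots. -/
theorem eq_of_forall_root_apply_eq (b : (rootSystem H).Base) {x y : H}
    (h : ∀ j : b.support, (rootSystem H).root j x = (rootSystem H).root j y) : x = y := by
  apply (Module.evalEquiv ℂ H).injective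
  refine b.toWeightBasis.ext fun j => ?_
  rw [b.toWeightBasis_apply]
  exact h j

theorem sigmaExp_apply_of_mem_rootSpace (b : (rootSystem H).Base) (α : b.support)
    {χ : H → ℂ} {x : L} (hx : x ∈ rootSpace H χ) :
    sigmaExp b α x = Complex.exp (Real.pi * Complex.I * χ (dualVector b α)) • x := by
  apply endExp_apply_of_apply_eq_smul
  have := lie_eq_smul_of_mem_rootSpace hx (dualVector b α)
  rw [LieSubalgebra.coe_bracket_of_module] at this
  rw [LinearMap.smul_apply, ad_apply, this, smul_smul]

/-- On root spaces this is additivity of weights under brackets together with multiplicativity of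
`exp`. -/
theorem sigmaExp_lie (b : (rootSystem H).Base) (α : b.support) (x y : L) :
    sigmaExp b α ⁅x, y⁆ = ⁅sigmaExp b α x, sigmaExp b α y⁆ := by
  induction x using rootSpace_induction H with
  | zero => simp
  | hadd x x' hx hx' => rw [add_lie, map_add, map_add, add_lie, hx, hx']
  | hmem χ x hx =>
    induction y using rootSpace_induction H with
    | zero => simp
    | hadd y y' hy hy' => rw [lie_add, map_add, map_add, lie_add, hy, hy']
    | hmem ψ y hy =>
      rw [sigmaExp_apply_of_mem_rootSpace b α (lie_mem_genWeightSpace_of_mem_genWeightSpace hx hy),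
        sigmaExp_apply_of_mem_rootSpace b α hx, sigmaExp_apply_of_mem_rootSpace b α hy,
        smul_lie, lie_smul, smul_smul, ← Complex.exp_add]
      congr 2
      rw [Pi.add_apply]
      ring

theorem exp_pi_mul_I_mul_intCast_mul_self (n : ℤ) :
    Complex.exp (Real.pi * Complex.I * n) * Complex.exp (Real.pi * Complex.I * n) = 1 := by
  rw [← Complex.exp_add, Complex.exp_eq_one_iff]
  exact ⟨n, by ring⟩

theorem exists_weight_apply_dualVector_eq_intCast (b : (rootSystem H).Base) (α : b.support)
    (χ : Weight ℂ H L) : ∃ n : ℤ, χ (dualVector b α) = n := by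
  rcases weight_isZero_or_exists_root χ with h | ⟨i, rfl⟩
  · exact ⟨0, by simp [h.eq]⟩
  · obtain ⟨n, hn⟩ := exists_coord_root_eq_intCast b α i
    exact ⟨n, by rw [root_apply_dualVector, hn]⟩

theorem sigmaExp_sigmaExp (b : (rootSystem H).Base) (α : b.support) (x : L) :
    sigmaExp b α (sigmaExp b α x) = x := by
  induction x using rootSpace_induction H with
  | zero => simp
  | hadd x x' hx hx' => rw [map_add, map_add, hx, hx']
  | hmem χ x hx =>
    obtain ⟨n, hn⟩ := exists_weight_apply_dualVector_eq_intCast b α χ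
    rw [sigmaExp_apply_of_mem_rootSpace b α hx, map_smul, sigmaExp_apply_of_mem_rootSpace b α hx,
      smul_smul, hn, exp_pi_mul_I_mul_intCast_mul_self, one_smul]

/-- The automorphism `exp(π i ad h_α^Δ)`. -/
def sigmaEquiv (b : (rootSystem H).Base) (α : b.support) : L ≃ₗ⁅ℂ⁆ L where
  toLinearMap := sigmaExp b α
  map_lie' := sigmaExp_lie b α _ _
  invFun := sigmaExp b α
  left_inv := sigmaExp_sigmaExp b α
  right_inv := sigmaExp_sigmaExp b α

theorem sigmaEquiv_apply (b : (rootSystem H).Base) (α : b.support) (x : L) :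
    sigmaEquiv b α x = sigmaExp b α x :=
  rfl

/-- If `α`, `β` and `α + β` are roots, then the bracket of the root spaces of `α` and `β` does not
vanish. -/
theorem exists_lie_ne_zero {α β γ : Weight ℂ H L} (hα : α.IsNonZero)
    (hγ : (γ : H → ℂ) = α + β) :
    ∃ x ∈ rootSpace H α, ∃ y ∈ rootSpace H β, ⁅x, y⁆ ≠ 0 := by
  obtain ⟨k, hk⟩ : ∃ k, chainTopCoeff α β = k + 1 := by
    have h₁ := (rootSpace_zsmul_add_ne_bot_iff α β hα 1).1 (by
      rw [one_smul, ← hγ]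
      exact γ.2)
    exact Nat.exists_eq_add_of_le' (by exact_mod_cast h₁.1)
  have hlen := chainTopCoeff_le_chainLength α β
  obtain ⟨x, hx, x_ne0⟩ := (chainTop α β).exists_ne_zero
  obtain ⟨h, e, f, isSl2, he, hf⟩ := exists_isSl2Triple_of_weight_isNonZero hα
  obtain rfl := isSl2.h_eq_coroot hα he hf
  have prim : isSl2.HasPrimitiveVectorWith x (chainLength α β : ℂ) :=
    have := lie_mem_genWeightSpace_of_mem_genWeightSpace he hx
    ⟨x_ne0, (chainLength_smul _ _ hx).symm, by rwa [genWeightSpace_add_chainTop _ _ hα] at this⟩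
  -- The vector `x` tops the `α`-chain through `β`, `k + 1` steps above `β`, so `f ^ (k + 1)`
  -- carries it into the root space of `β`. Applying `e` gives `(k + 1)(chainLength - k)` times `f ^
  -- k x`, which is nonzero.
  refine ⟨e, he, ((toEnd ℂ L L f) ^ (k + 1)) x, ?_, ?_⟩
  · have := toEnd_pow_apply_mem hf hx (k + 1)
    rwa [coe_chainTop', hk, smul_neg, neg_add_cancel_left] at this
  · rw [prim.lie_e_pow_succ_toEnd_f]
    refine smul_ne_zero (mul_ne_zero (by exact_mod_cast k.succ_ne_zero) ?_)
      (prim.pow_toEnd_f_ne_zero_of_eq_nat rfl (by omega))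
    rw [sub_ne_zero]
    exact_mod_cast (by omega : chainLength α β ≠ k)

end Lie

/-! ### Involutions of a Lie algebra and the ideal generated by `P`. -/

section Involution

open LieAlgebra

variable {L : Type*} [LieRing L] [LieAlgebra ℂ L] {σ : L ≃ₗ⁅ℂ⁆ L}

theorem mem_fixedPart {x : L} : x ∈ fixedPart σ ↔ σ x = x :=
  Iff.rfl

theorem mem_minusPart {x : L} : x ∈ minusPart σ ↔ σ x = -x :=
  Iff.rfl

theorem eq_zero_of_mem_fixedPart_of_mem_minusPart {x : L} (hx : x ∈ fixedPart σ)
    (hx' : x ∈ minusPart σ) : x = 0 := by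
  rw [mem_fixedPart] at hx
  rw [mem_minusPart, hx] at hx'
  have := IsAddTorsionFree.of_isTorsionFree ℂ L
  exact self_eq_neg.1 hx'

theorem exists_eq_add (hσ : ∀ x, σ (σ x) = x) (x : L) :
    ∃ k ∈ fixedPart σ, ∃ p ∈ minusPart σ, x = k + p := by
  refine ⟨(2⁻¹ : ℂ) • (x + σ x), ?_, (2⁻¹ : ℂ) • (x - σ x), ?_, ?_⟩
  · rw [mem_fixedPart, map_smul, map_add, hσ, add_comm]
  · rw [mem_minusPart, map_smul, map_sub, hσ, ← smul_neg, neg_sub]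
  · module

theorem coe_minusProj (hσ : ∀ x, σ (σ x) = x) (x : L) :
    (minusProj hσ x : L) = (2⁻¹ : ℂ) • (x - σ x) :=
  rfl

theorem minusProj_of_mem_fixedPart (hσ : ∀ x, σ (σ x) = x) {x : L} (hx : x ∈ fixedPart σ) :
    minusProj hσ x = 0 := by
  ext
  rw [coe_minusProj, mem_fixedPart.1 hx, sub_self, smul_zero]
  rfl

theorem minusProj_coe (hσ : ∀ x, σ (σ x) = x) (p : minusPart σ) :
    minusProj hσ (p : L) = p := by
  ext
  rw [coe_minusProj, mem_minusPart.1 p.2]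
  module

theorem lie_mem_fixedPart_of_mem_minusPart {x y : L} (hx : x ∈ minusPart σ)
    (hy : y ∈ minusPart σ) : ⁅x, y⁆ ∈ fixedPart σ := by
  rw [mem_minusPart] at hx hy
  rw [mem_fixedPart, LieEquiv.map_lie, hx, hy, neg_lie, lie_neg, neg_neg]

theorem mem_center_fixedPart_iff {z : fixedPart σ} :
    z ∈ center ℂ (fixedPart σ) ↔ ∀ k ∈ fixedPart σ, ⁅k, (z : L)⁆ = 0 := by
  rw [LieModule.mem_maxTrivSubmodule]
  refine ⟨fun h k hk => ?_, fun h k => ?_⟩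
  · exact congrArg Subtype.val (h ⟨k, hk⟩)
  · exact Subtype.ext (h k k.2)

theorem underlineForm_apply [FiniteDimensional ℂ L] (x y z : L) :
    underlineForm x y z = -killingForm ℂ L x ⁅y, z⁆ :=
  rfl

theorem killingForm_lie_left [FiniteDimensional ℂ L] (x y z : L) :
    killingForm ℂ L ⁅x, y⁆ z = killingForm ℂ L x ⁅y, z⁆ :=
  LieModule.traceForm_apply_lie_apply ℂ L L x y z

/-- The span of the brackets of elements of `P`. -/
def minusLieSpan (σ : L ≃ₗ⁅ℂ⁆ L) : Submodule ℂ L :=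
  Submodule.span ℂ {x : L | ∃ p q : minusPart σ, ⁅(p : L), (q : L)⁆ = x}

theorem minusLieSpan_le : minusLieSpan σ ≤ (fixedPart σ).toSubmodule := by
  rw [minusLieSpan, Submodule.span_le]
  rintro - ⟨p, q, rfl⟩
  exact lie_mem_fixedPart_of_mem_minusPart p.2 q.2

theorem lie_mem_minusLieSpan {x y : L} (hx : x ∈ fixedPart σ) (hy : y ∈ minusLieSpan σ) :
    ⁅x, y⁆ ∈ minusLieSpan σ := by
  induction hy using Submodule.span_induction with
  | zero => simp
  | add u v _ _ hu hv => rw [lie_add]; exact add_mem hu hv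
  | smul c u _ hu => rw [lie_smul]; exact Submodule.smul_mem _ _ hu
  | mem u hu =>
    obtain ⟨p, q, rfl⟩ := hu
    rw [leibniz_lie]
    exact add_mem (Submodule.subset_span ⟨⟨_, lie_mem_minusPart ⟨x, hx⟩ p⟩, q, rfl⟩)
      (Submodule.subset_span ⟨p, ⟨_, lie_mem_minusPart ⟨x, hx⟩ q⟩, rfl⟩)

/-- The ideal `P ⊕ [P, P]`. -/
def minusIdeal (hσ : ∀ x, σ (σ x) = x) : LieIdeal ℂ L where
  toSubmodule := minusPart σ ⊔ minusLieSpan σ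
  lie_mem {x m} hm := by
    obtain ⟨k, hk, p, hp, rfl⟩ := exists_eq_add hσ x
    obtain ⟨q, hq, c, hc, rfl⟩ := Submodule.mem_sup.1 hm
    have hpc : ⁅p, c⁆ ∈ minusPart σ := by
      rw [← lie_skew]
      exact neg_mem (lie_mem_minusPart ⟨c, minusLieSpan_le hc⟩ ⟨p, hp⟩)
    rw [add_lie, lie_add, lie_add]
    refine add_mem (add_mem (Submodule.mem_sup_left (lie_mem_minusPart ⟨k, hk⟩ ⟨q, hq⟩))
      (Submodule.mem_sup_right (lie_mem_minusLieSpan hk hc)))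
      (add_mem (Submodule.mem_sup_right (Submodule.subset_span ⟨⟨p, hp⟩, ⟨q, hq⟩, rfl⟩))
      (Submodule.mem_sup_left hpc))

/-- The ideal `P + [P, P]` contains some `x - σ x ≠ 0`, so it is everything by simplicity; comparing
`K`-components gives the claim. -/
theorem minusLieSpan_eq [IsSimple ℂ L] (hσ : ∀ x, σ (σ x) = x) (hne : ∃ x, σ x ≠ x) :
    minusLieSpan σ = (fixedPart σ).toSubmodule := by
  obtain ⟨x, hx⟩ := hne
  have hbot : minusIdeal hσ ≠ ⊥ := by
    intro hbot
    have hmem : x - σ x ∈ minusIdeal hσ := by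
      refine Submodule.mem_sup_left ?_
      rw [mem_minusPart, map_sub, hσ, neg_sub]
    rw [hbot, LieSubmodule.mem_bot, sub_eq_zero] at hmem
    exact hx hmem.symm
  have htop := (IsSimple.eq_bot_or_eq_top (R := ℂ) (minusIdeal hσ)).resolve_left hbot
  refine le_antisymm minusLieSpan_le fun k hk => ?_
  have hk' : k ∈ minusIdeal hσ := htop ▸ LieSubmodule.mem_top k
  obtain ⟨q, hq, c, hc, rfl⟩ := Submodule.mem_sup.1 hk'
  have hqk : q ∈ fixedPart σ := by
    have := sub_mem hk (minusLieSpan_le hc)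
    rwa [add_sub_cancel_right] at this
  rw [eq_zero_of_mem_fixedPart_of_mem_minusPart hqk hq, zero_add]
  exact hc

theorem eq_zero_of_forall_lie_eq_zero [FiniteDimensional ℂ L] [IsKilling ℂ L] {x : L}
    (h : ∀ y : L, ⁅x, y⁆ = 0) : x = 0 := by
  have hx : x ∈ center ℂ L := (LieModule.mem_maxTrivSubmodule ℂ L L x).2 fun y => by
    rw [← lie_skew, h, neg_zero]
  rwa [center_eq_bot, LieSubmodule.mem_bot] at hx

/-- A nontrivial involution of a simple Lie algebra defines a symmetric pair. -/
theorem isSymmetricPair [FiniteDimensional ℂ L] [IsSimple ℂ L] (hσ : ∀ x, σ (σ x) = x)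
    (hne : ∃ x, σ x ≠ x) : IsSymmetricPair σ where
  involutive := hσ
  span_lie := minusLieSpan_eq hσ hne
  faithful k hk := by
    -- By the Leibniz rule `k` kills `[P, P] = K` as well as `P`, so it is central.
    have hspan : ∀ c ∈ minusLieSpan σ, ⁅(k : L), c⁆ = 0 := by
      intro c hc
      induction hc using Submodule.span_induction with
      | zero => simp
      | add u v _ _ hu hv => rw [lie_add, hu, hv, add_zero]
      | smul c u _ hu => rw [lie_smul, hu, smul_zero]
      | mem u hu =>
        obtain ⟨p, q, rfl⟩ := hu
        rw [leibniz_lie, hk, hk, zero_lie, lie_zero, add_zero]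
    rw [minusLieSpan_eq hσ hne] at hspan
    refine Subtype.ext (eq_zero_of_forall_lie_eq_zero fun y => ?_)
    obtain ⟨c, hc, p, hp, rfl⟩ := exists_eq_add hσ y
    rw [lie_add, hspan c hc, hk ⟨p, hp⟩, add_zero]

end Involution

/-! ### From a simple root to the centre of `K` and a symplectic triple. -/

section Converse

open LieAlgebra LieAlgebra.IsKilling LieModule

variable {L : Type*} [LieRing L] [LieAlgebra ℂ L] [FiniteDimensional ℂ L] [IsKilling ℂ L]
  {H : LieSubalgebra ℂ L} [H.IsCartanSubalgebra]

theorem mem_rootSpace_zero {x : L} (hx : x ∈ H) : x ∈ rootSpace H (0 : H → ℂ) := by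
  rw [rootSpace_zero_eq]
  exact hx

theorem mem_fixedPart_sigmaEquiv_of_mem (b : (rootSystem H).Base) (α : b.support) {x : L}
    (hx : x ∈ H) : x ∈ fixedPart (sigmaEquiv b α) := by
  rw [mem_fixedPart, sigmaEquiv_apply, sigmaExp_apply_of_mem_rootSpace b α (mem_rootSpace_zero hx)]
  simp

/-- The Cartan subalgebra is its own centralizer. -/
theorem mem_of_forall_lie_eq_zero {z : L} (h : ∀ x ∈ H, ⁅x, z⁆ = 0) : z ∈ H := by
  rw [← LieSubalgebra.IsCartanSubalgebra.self_normalizing (H := H),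
    LieSubalgebra.mem_normalizer_iff']
  intro y hy
  rw [h y hy]
  exact zero_mem H

theorem lie_eq_smul {χ : H → ℂ} {x : L} (hx : x ∈ rootSpace H χ) (z : H) :
    ⁅(z : L), x⁆ = χ z • x := by
  have := lie_eq_smul_of_mem_rootSpace hx z
  rwa [LieSubalgebra.coe_bracket_of_module] at this

/-- An element of the centre of the fixed subalgebra annihilates the roots with even coefficient at
`α`. -/
theorem root_apply_eq_zero_of_central {b : (rootSystem H).Base} {α : b.support} {z : H}
    (hz : ∀ k ∈ fixedPart (sigmaEquiv b α), ⁅k, (z : L)⁆ = 0) {i : H.root} {n : ℤ}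
    (hi : b.toWeightBasis.coord α ((rootSystem H).root i) = 2 * n) :
    (rootSystem H).root i z = 0 := by
  obtain ⟨x, hx, hx0⟩ := i.1.exists_ne_zero
  have hfix : x ∈ fixedPart (sigmaEquiv b α) := by
    rw [mem_fixedPart, sigmaEquiv_apply, sigmaExp_apply_of_mem_rootSpace b α hx,
      root_apply_dualVector, hi, (Complex.exp_eq_one_iff).2 ⟨n, by ring⟩, one_smul]
  have h := hz x hfix
  rw [← lie_skew, lie_eq_smul hx, neg_eq_zero] at h
  exact (smul_eq_zero.1 h).resolve_right hx0

/-- The centre of the fixed subalgebra is contained in the line spanned by `h_α^Δ`. -/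
theorem exists_eq_smul_dualVector_of_central {b : (rootSystem H).Base} {α : b.support} {z : L}
    (hz : ∀ k ∈ fixedPart (sigmaEquiv b α), ⁅k, z⁆ = 0) :
    ∃ c : ℂ, z = c • (dualVector b α : L) := by
  classical
  have hzH : z ∈ H :=
    mem_of_forall_lie_eq_zero fun x hx => hz x (mem_fixedPart_sigmaEquiv_of_mem b α hx)
  refine ⟨(rootSystem H).root α ⟨z, hzH⟩, ?_⟩
  have : (⟨z, hzH⟩ : H) = (rootSystem H).root α ⟨z, hzH⟩ • dualVector b α := by
    refine eq_of_forall_root_apply_eq b fun j => ?_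
    rw [map_smul, apply_dualVector, coord_root_of_mem_support]
    by_cases hj : j = α
    · simp [hj]
    · rw [if_neg hj, smul_zero]
      -- A simple root other than `α` has coefficient 0 at `α`, so its root space lies in `K`.
      refine root_apply_eq_zero_of_central (n := 0) hz ?_
      rw [coord_root_of_mem_support, if_neg hj]
      simp
  exact congrArg Subtype.val this

theorem dualVector_ne_zero (b : (rootSystem H).Base) (α : b.support) :
    (dualVector b α : L) ≠ 0 := by
  classical
  intro h
  have h1 := apply_dualVector b α ((rootSystem H).root α)
  rw [coord_root_of_mem_support, if_pos rfl, Subtype.ext (h.trans H.coe_zero.symm), map_zero] at h1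
  exact zero_ne_one h1

theorem exists_sigmaEquiv_ne (b : (rootSystem H).Base) (α : b.support) :
    ∃ x, sigmaEquiv b α x ≠ x := by
  classical
  obtain ⟨x, hx, hx0⟩ := (α : H.root).1.exists_ne_zero
  refine ⟨x, fun h => hx0 ?_⟩
  rw [sigmaEquiv_apply, sigmaExp_apply_of_mem_rootSpace b α hx, root_apply_dualVector,
    coord_root_of_mem_support, if_pos rfl, mul_one, Complex.exp_pi_mul_I, neg_one_smul] at h
  have := IsAddTorsionFree.of_isTorsionFree ℂ L
  exact neg_eq_self.1 h

theorem weight_apply_dualVector_of_isAdmissibleSystem {b : (rootSystem H).Base} {α : b.support}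
    (h : IsAdmissibleSystem b α) (χ : Weight ℂ H L) :
    χ (dualVector b α) = 0 ∨ χ (dualVector b α) = 1 ∨ χ (dualVector b α) = -1 := by
  rcases weight_isZero_or_exists_root χ with h0 | ⟨i, rfl⟩
  · exact Or.inl (by simp [h0.eq])
  · rw [root_apply_dualVector]
    exact h.coord_root i

/-- Says that `ad h_α` kills `K`, in a form linear in `x`, so that it can be checked on root spaces:
`m (1 + exp(π i m)) = 0` for `m` in `{0, 1, -1}`. -/
theorem lie_dualVector_add_sigmaEquiv {b : (rootSystem H).Base} {α : b.support}
    (h : IsAdmissibleSystem b α) (x : L) :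
    ⁅(dualVector b α : L), x + sigmaEquiv b α x⁆ = 0 := by
  simp only [sigmaEquiv_apply]
  induction x using rootSpace_induction H with
  | zero => simp
  | hadd x y hx hy => rw [map_add, add_add_add_comm, lie_add, hx, hy, add_zero]
  | hmem χ x hx =>
    rw [sigmaExp_apply_of_mem_rootSpace b α hx, lie_add, lie_smul, lie_eq_smul hx]
    rcases weight_apply_dualVector_of_isAdmissibleSystem h χ with h0 | h0 | h0 <;> rw [h0]
    · simp
    · simp
    · simp

/-- Says that `(ad h_α)²` is the projection onto `P`; on root spaces, `2 m² = 1 - exp(π i m)`. -/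
theorem lie_dualVector_lie_dualVector {b : (rootSystem H).Base} {α : b.support}
    (h : IsAdmissibleSystem b α) (x : L) :
    (2 : ℂ) • ⁅(dualVector b α : L), ⁅(dualVector b α : L), x⁆⁆ = x - sigmaEquiv b α x := by
  simp only [sigmaEquiv_apply]
  induction x using rootSpace_induction H with
  | zero => simp
  | hadd x y hx hy => rw [map_add, lie_add, lie_add, smul_add, hx, hy, add_sub_add_comm]
  | hmem χ x hx =>
    rw [sigmaExp_apply_of_mem_rootSpace b α hx, lie_eq_smul hx, lie_smul, lie_eq_smul hx]
    rcases weight_apply_dualVector_of_isAdmissibleSystem h χ with h0 | h0 | h0 <;> rw [h0]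
    · simp
    · simp [two_smul]
    · simp [two_smul]

theorem lie_dualVector_eq_zero {b : (rootSystem H).Base} {α : b.support}
    (h : IsAdmissibleSystem b α) {x : L} (hx : x ∈ fixedPart (sigmaEquiv b α)) :
    ⁅(dualVector b α : L), x⁆ = 0 := by
  have h1 := lie_dualVector_add_sigmaEquiv h x
  rw [mem_fixedPart.1 hx, lie_add] at h1
  have := IsAddTorsionFree.of_isTorsionFree ℂ L
  exact self_eq_neg.1 (eq_neg_of_add_eq_zero_left h1)

theorem eq_zero_of_lie_dualVector_eq_zero {b : (rootSystem H).Base} {α : b.support}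
    (h : IsAdmissibleSystem b α) {x : L} (hx : x ∈ minusPart (sigmaEquiv b α))
    (h0 : ⁅(dualVector b α : L), x⁆ = 0) : x = 0 := by
  have h1 := lie_dualVector_lie_dualVector h x
  rw [h0, lie_zero, smul_zero, mem_minusPart.1 hx, sub_neg_eq_add] at h1
  have := IsAddTorsionFree.of_isTorsionFree ℂ L
  exact self_eq_neg.1 (eq_neg_of_add_eq_zero_left h1.symm)

theorem exists_mem_center_eq_dualVector {b : (rootSystem H).Base} {α : b.support}
    (h : IsAdmissibleSystem b α) :
    ∃ z ∈ center ℂ (fixedPart (sigmaEquiv b α)), (z : L) = dualVector b α := by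
  refine ⟨⟨_, mem_fixedPart_sigmaEquiv_of_mem b α (dualVector b α).2⟩, ?_, rfl⟩
  rw [mem_center_fixedPart_iff]
  intro k hk
  rw [← lie_skew, lie_dualVector_eq_zero h hk, neg_zero]

theorem finrank_center_fixedPart {b : (rootSystem H).Base} {α : b.support}
    (h : IsAdmissibleSystem b α) :
    Module.finrank ℂ (center ℂ (fixedPart (sigmaEquiv b α))) = 1 := by
  obtain ⟨z, hz, hzv⟩ := exists_mem_center_eq_dualVector h
  refine finrank_eq_one_iff'.2 ⟨⟨z, hz⟩, fun h0 => ?_, fun w => ?_⟩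
  · refine dualVector_ne_zero b α ?_
    rw [← hzv, show z = 0 from congrArg Subtype.val h0]
    rfl
  · obtain ⟨c, hc⟩ := exists_eq_smul_dualVector_of_central (mem_center_fixedPart_iff.1 w.2)
    exact ⟨c, Subtype.ext (Subtype.ext (by rw [hc, ← hzv]; rfl))⟩

variable [IsSimple ℂ L]

theorem center_fixedPart_ne_bot_iff (b : (rootSystem H).Base) (α : b.support) :
    center ℂ (fixedPart (sigmaEquiv b α)) ≠ ⊥ ↔ IsAdmissibleSystem b α := by
  refine ⟨fun hne => ?_, fun h hbot => ?_⟩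
  · by_contra h
    refine hne ((LieSubmodule.eq_bot_iff _).2 fun z hz => ?_)
    have : Nonempty H.root := ⟨α⟩
    -- This root space lies in `K`, so a central `c h_α` satisfies `2 c = 0`.
    obtain ⟨i, hi⟩ := exists_coord_root_eq_two h
    have hz' := mem_center_fixedPart_iff.1 hz
    obtain ⟨c, hc⟩ := exists_eq_smul_dualVector_of_central hz'
    have h0 := root_apply_eq_zero_of_central (z := c • dualVector b α) (i := i) (n := 1)
      (by rw [H.coe_smul, ← hc]; exact hz') (by rw [hi]; norm_num)
    rw [map_smul, apply_dualVector, hi, smul_eq_mul, mul_eq_zero] at h0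
    refine Subtype.ext ?_
    rw [hc, h0.resolve_right two_ne_zero, zero_smul]
    rfl
  · obtain ⟨z, hz, hzv⟩ := exists_mem_center_eq_dualVector h
    rw [hbot, LieSubmodule.mem_bot] at hz
    exact dualVector_ne_zero b α (by rw [← hzv, hz]; rfl)

/-- Invariance follows from `[h_α, K] = 0`. If `p` is in the radical, `[h_α, p]` is
Killing-orthogonal to `P`, and to `K` by the same vanishing; so it is zero, and `p = 0` since `ad
h_α` is injective on `P`. -/
theorem isComplexTriple_sigmaEquiv {b : (rootSystem H).Base} {α : b.support}
    (h : IsAdmissibleSystem b α) {c : ℂ} (hc : c ≠ 0) :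
    IsComplexTriple (sigmaEquiv b α)
      (c • (underlineForm (dualVector b α : L)).restrict (minusPart (sigmaEquiv b α))) := by
  have happ : ∀ p q : minusPart (sigmaEquiv b α),
      (c • (underlineForm (dualVector b α : L)).restrict (minusPart (sigmaEquiv b α))) p q =
        -(c * killingForm ℂ L (dualVector b α) ⁅(p : L), (q : L)⁆) := fun p q => mul_neg _ _
  have halt : (c • (underlineForm (dualVector b α : L)).restrict
      (minusPart (sigmaEquiv b α))).IsAlt := by
    intro p
    rw [happ, lie_self, map_zero, mul_zero, neg_zero]
  refine { isSymmetricPair (sigmaExp_sigmaExp b α) (exists_sigmaEquiv_ne b α) with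
    alt := halt, nondegenerate := ?_, invariant := ?_ }
  · refine halt.isRefl.nondegenerate_iff_separatingLeft.2 fun p hp => ?_
    refine Subtype.ext (eq_zero_of_lie_dualVector_eq_zero h p.2 ?_)
    refine (killingForm_nondegenerate ℂ L).1 _ fun y => ?_
    obtain ⟨k, hk, q, hq, rfl⟩ := exists_eq_add (σ := sigmaEquiv b α) (sigmaExp_sigmaExp b α) y
    rw [killingForm_lie_left, lie_add, map_add]
    have h1 := hp ⟨q, hq⟩
    rw [happ, neg_eq_zero, mul_eq_zero] at h1
    rw [h1.resolve_left hc, add_zero, ← lie_skew, map_neg, ← killingForm_lie_left,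
      lie_dualVector_eq_zero h hk, map_zero, LinearMap.zero_apply, neg_zero]
  · intro k p q
    rw [happ, happ, ← neg_add, ← mul_add, ← map_add, ← leibniz_lie, ← killingForm_lie_left,
      lie_dualVector_eq_zero h k.2, map_zero, LinearMap.zero_apply, mul_zero, neg_zero]

end Converse

/-! ### The element `X` representing the symplectic form. -/

section Moment

open LieAlgebra LieAlgebra.IsKilling

variable {L : Type*} [LieRing L] [LieAlgebra ℂ L] {σ : L ≃ₗ⁅ℂ⁆ L}
  {Ω : LinearMap.BilinForm ℂ (minusPart σ)}

theorem extendForm_apply (hσ : ∀ x, σ (σ x) = x) (x y : L) :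
    extendForm hσ Ω x y = Ω (minusProj hσ x) (minusProj hσ y) :=
  rfl

theorem minusProj_lie (hσ : ∀ x, σ (σ x) = x) (k l : fixedPart σ) (p q : minusPart σ) :
    minusProj hσ ⁅(k : L) + p, (l : L) + q⁆ =
      ⟨⁅(k : L), (q : L)⁆, lie_mem_minusPart k q⟩ -
        ⟨⁅(l : L), (p : L)⁆, lie_mem_minusPart l p⟩ := by
  have h1 : ⁅(p : L), (l : L)⁆ = -⁅(l : L), (p : L)⁆ := (lie_skew _ _).symm
  rw [add_lie, lie_add, lie_add, h1, map_add, map_add, map_add, map_neg,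
    minusProj_of_mem_fixedPart hσ ((fixedPart σ).lie_mem k.2 l.2),
    minusProj_of_mem_fixedPart hσ (lie_mem_fixedPart_of_mem_minusPart p.2 q.2),
    minusProj_coe hσ ⟨⁅(k : L), (q : L)⁆, lie_mem_minusPart k q⟩,
    minusProj_coe hσ ⟨⁅(l : L), (p : L)⁆, lie_mem_minusPart l p⟩]
  abel

theorem minusProj_add (hσ : ∀ x, σ (σ x) = x) (k : fixedPart σ) (p : minusPart σ) :
    minusProj hσ ((k : L) + p) = p := by
  rw [map_add, minusProj_of_mem_fixedPart hσ k.2, minusProj_coe, zero_add]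

/-- The extension of the symplectic form is closed. -/
theorem extendForm_lie (t : IsComplexTriple σ Ω) (x y z : L) :
    extendForm t.involutive Ω ⁅x, y⁆ z =
      extendForm t.involutive Ω x ⁅y, z⁆ - extendForm t.involutive Ω y ⁅x, z⁆ := by
  obtain ⟨k, hk, p, hp, rfl⟩ := exists_eq_add t.involutive x
  obtain ⟨l, hl, q, hq, rfl⟩ := exists_eq_add t.involutive y
  obtain ⟨m, hm, r, hr, rfl⟩ := exists_eq_add t.involutive z
  lift k to fixedPart σ using hk
  lift l to fixedPart σ using hl
  lift m to fixedPart σ using hm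
  lift p to minusPart σ using hp
  lift q to minusPart σ using hq
  lift r to minusPart σ using hr
  simp only [extendForm_apply, minusProj_lie, minusProj_add, map_sub, LinearMap.sub_apply]
  -- Only brackets of `K` with `P` survive the projection; what is left is invariance under each of
  -- the three `K`-components.
  have h1 := t.invariant k q r
  have h2 := t.invariant l p r
  have h3 := t.invariant m p q
  have h4 := LinearMap.BilinForm.IsAlt.neg_eq t.alt ⟨⁅(m : L), (p : L)⁆, lie_mem_minusPart m p⟩ q
  linear_combination h1 - h2 + h3 + h4

variable [FiniteDimensional ℂ L]

/-- The symplectic form of a triple is represented by an element whose centralizer is `K`. -/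
theorem exists_extendForm_eq [IsKilling ℂ L] (t : IsComplexTriple σ Ω) :
    ∃ X : L, extendForm t.involutive Ω = -underlineForm X ∧
      ∀ x, ⁅X, x⁆ = 0 ↔ x ∈ fixedPart σ := by
  set E := extendForm t.involutive Ω with hE
  have hβ := killingForm_nondegenerate ℂ L
  set D := E.symmCompOfNondegenerate (killingForm ℂ L) hβ with hD
  have hDE : ∀ x y, killingForm ℂ L (D x) y = E x y := fun x y =>
    LinearMap.BilinForm.symmCompOfNondegenerate_left_apply E hβ y x
  -- The Leibniz rule for `D`, tested against `z` with the Killing form, is the closedness of `E`.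
  let δ : LieDerivation ℂ L L :=
    { toLinearMap := D
      leibniz' := fun a b => by
        refine sub_eq_zero.1 (hβ.1 _ fun z => ?_)
        have h1 : ⁅a, D b⁆ = -⁅D b, a⁆ := (lie_skew _ _).symm
        have h2 : ⁅b, D a⁆ = -⁅D a, b⁆ := (lie_skew _ _).symm
        rw [h1, h2, map_sub, map_sub, map_neg, map_neg]
        simp only [LinearMap.sub_apply, LinearMap.neg_apply]
        rw [killingForm_lie_left, killingForm_lie_left, hDE, hDE, hDE, extendForm_lie t]
        ring }
  obtain ⟨X, hX⟩ := LieDerivation.IsKilling.exists_eq_ad δ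
  have hXD : ∀ x, ⁅X, x⁆ = D x := fun x => by
    have := congrArg (fun d : LieDerivation ℂ L L => d x) hX
    rwa [LieDerivation.ad_apply_apply] at this
  have hXE : ∀ x y, killingForm ℂ L X ⁅x, y⁆ = E x y := fun x y => by
    rw [← killingForm_lie_left, hXD, hDE]
  refine ⟨X, ?_, fun x => ⟨fun h => ?_, fun h => ?_⟩⟩
  · ext x y
    rw [LinearMap.neg_apply, LinearMap.neg_apply, underlineForm_apply, hXE, neg_neg]
  · obtain ⟨k, hk, p, hp, rfl⟩ := exists_eq_add t.involutive x
    have hp0 : (⟨p, hp⟩ : minusPart σ) = 0 := by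
      refine t.nondegenerate.1 _ fun q => ?_
      have := hXE (k + p) q
      rw [← killingForm_lie_left, h, map_zero, LinearMap.zero_apply, hE, extendForm_apply,
        minusProj_coe, minusProj_add t.involutive ⟨k, hk⟩ ⟨p, hp⟩] at this
      exact this.symm
    rw [show p = 0 from congrArg Subtype.val hp0, add_zero]
    exact hk
  · refine hβ.1 _ fun y => ?_
    rw [killingForm_lie_left, hXE, hE, extendForm_apply, minusProj_of_mem_fixedPart _ h,
      map_zero, LinearMap.zero_apply]

/-- If `K` is the centralizer of an element, then a Cartan subalgebra of `K` is one of `L`. -/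
theorem exists_isCartanSubalgebra_center_le (hσ : ∀ x, σ (σ x) = x) {X : L}
    (hX : ∀ x, ⁅X, x⁆ = 0 ↔ x ∈ fixedPart σ) :
    ∃ H : LieSubalgebra ℂ L, H.IsCartanSubalgebra ∧
      ∀ z ∈ center ℂ (fixedPart σ), (z : L) ∈ H := by
  obtain ⟨x₀, hx₀⟩ := exists_isCartanSubalgebra_engel ℂ (fixedPart σ)
  set C := LieSubalgebra.engel ℂ x₀
  have hCmem : ∀ z : fixedPart σ, (∀ y ∈ C, ⁅y, z⁆ ∈ C) → z ∈ C := fun z hz => by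
    rwa [← LieSubalgebra.mem_normalizer_iff',
      LieSubalgebra.IsCartanSubalgebra.self_normalizing] at hz
  have hcenter : ∀ z ∈ center ℂ (fixedPart σ), z ∈ C := fun z hz => hCmem z fun y _ => by
    rw [(LieModule.mem_maxTrivSubmodule ℂ _ _ z).1 hz y]
    exact zero_mem C
  have hXK : X ∈ fixedPart σ := (hX X).1 (lie_self X)
  have hXC : (⟨X, hXK⟩ : fixedPart σ) ∈ C := hcenter _ <| mem_center_fixedPart_iff.2 fun k hk => by
    rw [← lie_skew, (hX k).2 hk, neg_zero]
  have hmap : ∀ {y : L}, y ∈ C.map (fixedPart σ).incl ↔ ∃ c ∈ C, (c : L) = y := by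
    intro y
    rw [LieSubalgebra.mem_map]
    rfl
  refine ⟨C.map (fixedPart σ).incl, ⟨?_, ?_⟩, fun z hz => hmap.2 ⟨z, hcenter z hz, rfl⟩⟩
  · rw [← (C.equivMapOfInjective (f := (fixedPart σ).incl)
      Subtype.val_injective).nilpotent_iff_equiv_nilpotent]
    infer_instance
  · refine le_antisymm (fun y hy => ?_) (LieSubalgebra.le_normalizer _)
    rw [LieSubalgebra.mem_normalizer_iff'] at hy
    -- If `y = k + p` normalizes `C`, then `[X, y] = [X, p]` lies in both `K` and `P`; it vanishes,
    -- so `p` centralizes `X` and lies in `K`.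
    have hyK : y ∈ fixedPart σ := by
      obtain ⟨c, -, hc⟩ := hmap.1 (hy X (hmap.2 ⟨_, hXC, rfl⟩))
      obtain ⟨k, hk, p, hp, rfl⟩ := exists_eq_add hσ y
      rw [lie_add, (hX k).2 hk, zero_add] at hc
      have h0 : ⁅X, p⁆ = 0 := eq_zero_of_mem_fixedPart_of_mem_minusPart (hc ▸ c.2)
        (lie_mem_minusPart ⟨X, hXK⟩ ⟨p, hp⟩)
      exact add_mem hk ((hX p).1 h0)
    refine hmap.2 ⟨⟨y, hyK⟩, hCmem _ fun c hc => ?_, rfl⟩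
    obtain ⟨d, hd, hdy⟩ := hmap.1 (hy c (hmap.2 ⟨c, hc, rfl⟩))
    rwa [show ⁅c, (⟨y, hyK⟩ : fixedPart σ)⁆ = d from Subtype.ext hdy.symm]

end Moment

/-! ### From `X` to an admissible system. -/

section Forward

open LieAlgebra LieAlgebra.IsKilling LieModule

variable {L : Type*} [LieRing L] [LieAlgebra ℂ L] [FiniteDimensional ℂ L] [IsKilling ℂ L]
  {σ : L ≃ₗ⁅ℂ⁆ L} {H : LieSubalgebra ℂ L} [H.IsCartanSubalgebra]

/-- `ad X` kills `K` and preserves `P`, so its image lies in `P`; on this root space it is a nonzero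
scalar. -/
theorem mem_minusPart_of_mem_rootSpace (hσ : ∀ x, σ (σ x) = x) {X : H}
    (hX : ∀ x, ⁅(X : L), x⁆ = 0 ↔ x ∈ fixedPart σ) {χ : H → ℂ} {x : L} (hx : x ∈ rootSpace H χ)
    (hχ : χ X ≠ 0) : x ∈ minusPart σ := by
  obtain ⟨k, hk, p, hp, rfl⟩ := exists_eq_add hσ x
  have h := lie_eq_smul hx X
  rw [lie_add, (hX k).2 hk, zero_add] at h
  have hmem : χ X • (k + p) ∈ minusPart σ := by
    rw [← h]
    exact lie_mem_minusPart (σ := σ) ⟨(X : L), (hX X).1 (lie_self _)⟩ ⟨p, hp⟩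
  exact ((minusPart σ).smul_mem_iff hχ).1 hmem

theorem mem_fixedPart_of_mem_rootSpace {X : H}
    (hX : ∀ x, ⁅(X : L), x⁆ = 0 ↔ x ∈ fixedPart σ) {χ : H → ℂ} {x : L} (hx : x ∈ rootSpace H χ)
    (hχ : χ X = 0) : x ∈ fixedPart σ := by
  rw [← hX, lie_eq_smul hx, hχ, zero_smul]

/-- The sum of two roots of `P` is not a root of `P`. -/
theorem root_apply_eq_zero_of_eq_add (hσ : ∀ x, σ (σ x) = x) {X : H}
    (hX : ∀ x, ⁅(X : L), x⁆ = 0 ↔ x ∈ fixedPart σ) {i j k : H.root}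
    (hk : (rootSystem H).root k = (rootSystem H).root i + (rootSystem H).root j)
    (hi : (rootSystem H).root i X ≠ 0) (hj : (rootSystem H).root j X ≠ 0) :
    (rootSystem H).root k X = 0 := by
  have hk' : (k.1 : H → ℂ) = i.1 + j.1 := funext fun x => LinearMap.congr_fun hk x
  obtain ⟨x, hx, y, hy, hne⟩ := exists_lie_ne_zero (H.isNonZero_coe_root i) hk'
  have hxy := lie_mem_genWeightSpace_of_mem_genWeightSpace hx hy
  rw [← hk'] at hxy
  have h := (hX ⁅x, y⁆).2 (lie_mem_fixedPart_of_mem_minusPart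
    (mem_minusPart_of_mem_rootSpace hσ hX hx hi) (mem_minusPart_of_mem_rootSpace hσ hX hy hj))
  rw [lie_eq_smul hxy] at h
  exact (smul_eq_zero.1 h).resolve_right hne

/-- There is a base for which all simple roots but one vanish at `X`, and the exceptional simple
root has coefficient `1` in the highest root. -/
theorem exists_isAdmissibleSystem [IsSimple ℂ L] (hσ : ∀ x, σ (σ x) = x) {X : H} (hX0 : X ≠ 0)
    (hX : ∀ x, ⁅(X : L), x⁆ = 0 ↔ x ∈ fixedPart σ) :
    ∃ (b : (rootSystem H).Base) (γ : b.support), IsAdmissibleSystem b γ ∧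
      (rootSystem H).root γ X ≠ 0 ∧
      ∀ j : b.support, j ≠ γ → (rootSystem H).root j X = 0 := by
  classical
  -- The values of roots at `X` are complex; `φ` supplies signs for them without killing any nonzero
  -- one.
  obtain ⟨φ, hφ⟩ : ∃ φ : Module.Dual ℚ ℂ,
      ∀ i : {i // (rootSystem H).root i X ≠ 0}, φ ((rootSystem H).root i X) ≠ 0 :=
    Module.exists_dual_forall_apply_ne_zero _ fun i => i.2
  obtain ⟨b, hb⟩ := exists_base_forall_nonneg (rootSystem H)
    (φ.toAddMonoidHom.comp (Module.Dual.eval ℂ H X).toAddMonoidHom)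
  replace hb : ∀ i ∈ b.support, (rootSystem H).root i X ≠ 0 → 0 < φ ((rootSystem H).root i X) :=
    fun i hi h0 => lt_of_le_of_ne (hb i hi) (hφ ⟨i, h0⟩).symm
  obtain ⟨γ₀, hγ₀⟩ : ∃ γ : b.support, (rootSystem H).root γ X ≠ 0 := by
    by_contra! h
    exact hX0 (eq_of_forall_root_apply_eq b fun j => by rw [h j, map_zero])
  have : Nonempty H.root := ⟨γ₀⟩
  obtain ⟨μ, hμ⟩ := exists_isHighestRoot b
  obtain ⟨n, hn, hsum⟩ := hμ.exists_eq_sum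
  have hpos : b.IsPos μ :=
    (isPos_iff_root_mem_closure b μ).2 ((mem_closure_root_iff b).2 ⟨n, hsum⟩)
  -- Invariant of the climb to `μ`: either no simple root of `P` has been used, or exactly one, `γ`,
  -- exactly once.
  let p : H.root → Prop := fun i =>
    ((rootSystem H).root i X = 0 ∧ ∀ δ : b.support, (rootSystem H).root δ X ≠ 0 →
      b.toWeightBasis.coord δ ((rootSystem H).root i) = 0) ∨
    ∃ γ : b.support, (rootSystem H).root γ X ≠ 0 ∧
      (rootSystem H).root i X = (rootSystem H).root γ X ∧
      ∀ δ : b.support, (rootSystem H).root δ X ≠ 0 →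
        b.toWeightBasis.coord δ ((rootSystem H).root i) = if γ = δ then 1 else 0
  have key : p μ := by
    refine hpos.induction_on_add (p := p) ?_ ?_
    · intro i hi
      by_cases h0 : (rootSystem H).root i X = 0
      · refine Or.inl ⟨h0, fun δ hδ => ?_⟩
        rw [coord_root_of_mem_support b δ ⟨i, hi⟩, if_neg]
        rintro rfl
        exact hδ h0
      · exact Or.inr ⟨⟨i, hi⟩, h0, rfl, fun δ _ => coord_root_of_mem_support b δ ⟨i, hi⟩⟩
    · intro i j k hk hi hj
      have hkX : (rootSystem H).root k X = (rootSystem H).root i X + (rootSystem H).root j X := by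
        rw [hk, LinearMap.add_apply]
      by_cases h0 : (rootSystem H).root j X = 0
      · have hcoord : ∀ δ : b.support, (rootSystem H).root δ X ≠ 0 →
            b.toWeightBasis.coord δ ((rootSystem H).root k) =
              b.toWeightBasis.coord δ ((rootSystem H).root i) := by
          intro δ hδ
          rw [hk, map_add, coord_root_of_mem_support b δ ⟨j, hj⟩, if_neg, add_zero]
          rintro rfl
          exact hδ h0
        rcases hi with ⟨hi, hi'⟩ | ⟨γ, hγ, hi, hi'⟩
        · exact Or.inl ⟨by rw [hkX, hi, h0, add_zero], fun δ hδ => by rw [hcoord δ hδ, hi' δ hδ]⟩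
        · exact Or.inr ⟨γ, hγ, by rw [hkX, hi, h0, add_zero],
            fun δ hδ => by rw [hcoord δ hδ, hi' δ hδ]⟩
      · rcases hi with ⟨hi, hi'⟩ | ⟨γ, hγ, hi, -⟩
        · refine Or.inr ⟨⟨j, hj⟩, h0, by rw [hkX, hi, zero_add], fun δ hδ => ?_⟩
          rw [hk, map_add, hi' δ hδ, zero_add]
          exact coord_root_of_mem_support b δ ⟨j, hj⟩
        -- Adding a second simple root `j` of `P` would give `γ(X) + j(X) = 0`, but `φ` is positive
        -- on both terms.
        · have hzero := root_apply_eq_zero_of_eq_add hσ hX hk (hi ▸ hγ) h0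
          rw [hkX, hi] at hzero
          have hφ0 := congrArg φ hzero
          rw [map_add, map_zero] at hφ0
          linarith [hb γ γ.2 hγ, hb j hj h0]
  have hcoord : ∀ δ : b.support, b.toWeightBasis.coord δ ((rootSystem H).root μ) = n δ :=
    fun δ => by rw [hsum, coord_sum_smul_root]
  rcases key with ⟨-, h⟩ | ⟨γ, hγ, -, h⟩
  · have h1 := h γ₀ hγ₀
    rw [hcoord, Nat.cast_eq_zero] at h1
    have := hn γ₀
    omega
  · refine ⟨b, γ, ⟨μ, hμ, n, ?_, hsum⟩, hγ, fun j hj => ?_⟩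
    · have h1 := h γ hγ
      rw [hcoord, if_pos rfl] at h1
      exact_mod_cast h1
    · by_contra hjX
      have h1 := h j hjX
      rw [hcoord, if_neg hj.symm, Nat.cast_eq_zero] at h1
      have := hn j
      omega

theorem eq_smul_dualVector {b : (rootSystem H).Base} {γ : b.support} {X : H}
    (h : ∀ j : b.support, j ≠ γ → (rootSystem H).root j X = 0) :
    X = (rootSystem H).root γ X • dualVector b γ := by
  classical
  refine eq_of_forall_root_apply_eq b fun j => ?_
  rw [map_smul, apply_dualVector, coord_root_of_mem_support]
  by_cases hj : j = γ
  · simp [hj]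
  · rw [if_neg hj, smul_zero, h j hj]

/-- On each root space both sides are the same sign: `χ(X) = c χ(h_γ)` with `χ(h_γ)` in `{0, 1,
-1}`, and `exp(±π i) = -1`. -/
theorem eq_sigmaExp (hσ : ∀ x, σ (σ x) = x) {X : H}
    (hX : ∀ x, ⁅(X : L), x⁆ = 0 ↔ x ∈ fixedPart σ) {b : (rootSystem H).Base} {γ : b.support}
    (hadm : IsAdmissibleSystem b γ) {c : ℂ} (hc : c ≠ 0) (hXc : X = c • dualVector b γ) (x : L) :
    σ x = sigmaExp b γ x := by
  induction x using rootSpace_induction H with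
  | zero => simp
  | hadd x y hx hy => rw [map_add, map_add, hx, hy]
  | hmem χ x hx =>
    have hχ : χ X = c * χ (dualVector b γ) := by
      have := map_smul χ.toLinear c (dualVector b γ)
      rw [← hXc] at this
      exact this
    rw [sigmaExp_apply_of_mem_rootSpace b γ hx]
    by_cases h0 : χ X = 0
    · have h1 : χ (dualVector b γ) = 0 := (mul_eq_zero.1 (hχ ▸ h0)).resolve_left hc
      rw [mem_fixedPart.1 (mem_fixedPart_of_mem_rootSpace hX hx h0), h1]
      simp
    · rw [mem_minusPart.1 (mem_minusPart_of_mem_rootSpace hσ hX hx h0)]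
      rcases weight_apply_dualVector_of_isAdmissibleSystem hadm χ with h1 | h1 | h1
      · exact absurd (by rw [hχ, h1, mul_zero]) h0
      · rw [h1]
        simp
      · rw [h1]
        simp

end Forward

end SymplecticTriple

end

theorem mainTheorem9 {L : Type*} [LieRing L] [LieAlgebra ℂ L] [FiniteDimensional ℂ L]
    [LieAlgebra.IsSimple ℂ L] :
    -- every simple complex triple comes from an admissible system
    (∀ (σ : L ≃ₗ⁅ℂ⁆ L) (Ω : LinearMap.BilinForm ℂ (SymplecticTriple.minusPart σ))
      (t : SymplecticTriple.IsComplexTriple σ Ω),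
      (∃ H : LieSubalgebra ℂ L, H.IsCartanSubalgebra ∧
        ∀ z ∈ LieAlgebra.center ℂ (SymplecticTriple.fixedPart σ), (z : L) ∈ H) ∧
      ∀ (H : LieSubalgebra ℂ L) [H.IsCartanSubalgebra],
        (∀ z ∈ LieAlgebra.center ℂ (SymplecticTriple.fixedPart σ), (z : L) ∈ H) →
        ∃ (Δ : (LieAlgebra.IsKilling.rootSystem H).Base) (γ : Δ.support) (c : ℂ),
          SymplecticTriple.IsAdmissibleSystem Δ γ ∧
          (∀ x, σ x = SymplecticTriple.sigmaExp Δ γ x) ∧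
          SymplecticTriple.extendForm t.involutive Ω =
            c • SymplecticTriple.underlineForm (SymplecticTriple.dualVector Δ γ : L)) ∧
    -- converse, for any Cartan subalgebra, any base and any simple root
    (∀ (H : LieSubalgebra ℂ L) [H.IsCartanSubalgebra]
      (Δ : (LieAlgebra.IsKilling.rootSystem H).Base) (α : Δ.support),
      ∃ σ : L ≃ₗ⁅ℂ⁆ L,
        (∀ x, σ x = SymplecticTriple.sigmaExp Δ α x) ∧
        (∀ x, σ (σ x) = x) ∧ (∃ x, σ x ≠ x) ∧
        (LieAlgebra.center ℂ (SymplecticTriple.fixedPart σ) ≠ ⊥ ↔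
          SymplecticTriple.IsAdmissibleSystem Δ α) ∧
        (SymplecticTriple.IsAdmissibleSystem Δ α →
          Module.finrank ℂ (LieAlgebra.center ℂ (SymplecticTriple.fixedPart σ)) = 1 ∧
          ∀ c : ℂ, c ≠ 0 →
            SymplecticTriple.IsComplexTriple σ
              (c • (SymplecticTriple.underlineForm
                (SymplecticTriple.dualVector Δ α : L)).restrict
                  (SymplecticTriple.minusPart σ)))) := by
  refine ⟨fun σ Ω t => ?_, fun H _ Δ α => ?_⟩
  · obtain ⟨X, hΩ, hX⟩ := SymplecticTriple.exists_extendForm_eq t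
    refine ⟨SymplecticTriple.exists_isCartanSubalgebra_center_le t.involutive hX,
      fun H _ hH => ?_⟩
    have hXH : X ∈ H := hH ⟨X, (hX X).1 (lie_self X)⟩ <|
      SymplecticTriple.mem_center_fixedPart_iff.2 fun k hk => by
        rw [← lie_skew, (hX k).2 hk, neg_zero]
    -- If `X = 0`, its centralizer `K` is everything; then `P = 0` and `K = [P, P] = 0`, so the
    -- algebra would be abelian.
    have hX0 : (⟨X, hXH⟩ : H) ≠ 0 := by
      intro h0
      have hzero : X = 0 := congrArg Subtype.val h0
      have hfix : ∀ x, x ∈ SymplecticTriple.fixedPart σ := fun x => by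
        rw [← hX, hzero, zero_lie]
      have hall : ∀ x : L, x = 0 := fun x => by
        have hx : x ∈ SymplecticTriple.minusLieSpan σ := by
          rw [SymplecticTriple.minusLieSpan, t.span_lie]
          exact hfix x
        rw [SymplecticTriple.minusLieSpan, (Submodule.span_eq_bot (R := ℂ)).2] at hx
        · exact hx
        · rintro - ⟨p, q, rfl⟩
          rw [SymplecticTriple.eq_zero_of_mem_fixedPart_of_mem_minusPart (hfix p) p.2, zero_lie]
      exact LieAlgebra.IsSimple.non_abelian ℂ (L := L) ⟨fun x y => hall _⟩
    obtain ⟨Δ, γ, hadm, hγ, hj⟩ :=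
      SymplecticTriple.exists_isAdmissibleSystem t.involutive hX0 hX
    have hXc := SymplecticTriple.eq_smul_dualVector hj
    -- The sign comes from the minus in the definition of `underlineForm`.
    refine ⟨Δ, γ, -(LieAlgebra.IsKilling.rootSystem H).root γ ⟨X, hXH⟩, hadm,
      SymplecticTriple.eq_sigmaExp t.involutive hX hadm hγ hXc, ?_⟩
    rw [hΩ]
    ext x y
    have hXc' : X = (LieAlgebra.IsKilling.rootSystem H).root γ ⟨X, hXH⟩ •
        (SymplecticTriple.dualVector Δ γ : L) := congrArg Subtype.val hXc
    generalize (LieAlgebra.IsKilling.rootSystem H).root γ ⟨X, hXH⟩ = c at hXc'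
    rw [hXc']
    simp [SymplecticTriple.underlineForm_apply]
  · refine ⟨SymplecticTriple.sigmaEquiv Δ α, fun x => rfl,
      SymplecticTriple.sigmaExp_sigmaExp Δ α, SymplecticTriple.exists_sigmaEquiv_ne Δ α,
      SymplecticTriple.center_fixedPart_ne_bot_iff Δ α, fun h => ⟨?_, fun c hc => ?_⟩⟩
    · exact SymplecticTriple.finrank_center_fixedPart h
    · exact SymplecticTriple.isComplexTriple_sigmaEquiv h hc
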